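/- Let $d\ge 0$, $T>0$, $Q_T=(0,T)\times\mathbb{R}^d$, let $K\subset Q_T$ be compact, and let $p\ge 1$. Let $u^n$ be real-valued measurable functions on $K$ that are uniformly bounded in $L^p(K)$ and $L^p$-uniformly integrable: $$\sup_n\int_K|u^n|^p\,dt\,dx<\infty,\qquad \sup_n\int_{\{(t,x)\in K:\,|u^n|\ge c\}}|u^n|^p\,dt\,dx\to 0\quad\text{as } c\to\infty .$$ Let $\chi(\xi,u)=\mathbf 1_{0<\xi<u}$ for $u>0$, $\chi(\xi,u)=-\mathbf 1_{u<\xi<0}$ for $u<0$, $\chi(\xi,0)=0$, and suppose that $\chi(\xi,u^n(t,x))\rightharpoonup g(t,x,\xi)$ weak-$*$ in $L^\infty(K\times\mathbb{R})$. Let $S:\mathbb{R}\to\mathbb{R}$ be continuous, locally absolutely continuous, with $$|S'(\xi)|\le C(|\xi|^{p-1}+1)\quad\text{for a.e. }\xi\in\mathbb{R}$$ for some constant $C$ (in particular, $S$ may be any differentiable function satisfying this bound everywhere). Then $\xi\mapsto S'(\xi)g(t,x,\xi)$ is integrable on $\mathbb{R}$ for a.e. $(t,x)\in K$, and $$S(u^n)\rightharpoonup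 S(0)+\int_{\mathbb{R}}S'(\xi)\,g(t,x,\xi)\,d\xi\quad\text{weakly in }L^1(K).$$ Moreover, let $(\nu_{(t,x)})_{(t,x)\in K}$ be the Young measure generated by $\{u^n\}$, that is, a family of probability measures on $\mathbb{R}$ (for a.e. $(t,x)$) such that for every continuous $f:\mathbb{R}\to\mathbb{R}$ vanishing at infinity, $(t,x)\mapsto\int f\,d\nu_{(t,x)}$ is measurable and $f(u^n)\rightharpoonup\int f\,d\nu_{(t,x)}$ weak-$*$ in $L^\infty(K)$. Then $S$ is $\nu_{(t,x)}$-integrable for a.e. $(t,x)\in K$, $S(u^n)\rightharpoonup\int S(\xi)\,d\nu_{(t,x)}(\xi)$ weakly in $L^1(K)$, and $$\int S(\xi)\,d\nu_{(t,x)}(\xi)=S(0)+\int_{\mathbb{R}}S'(\xi)\,g(t,x,\xi)\,d\xi\qquad\text{for a.e. }(t,x)\in K .$$ -/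

import Mathlib

open MeasureTheory Filter Topology

noncomputable section

/-- Uniform boundedness in `L^p(μ)` together with `L^p`-uniform integrability of a sequence:
`sup_n ∫ |u^n|^p < ∞` and `sup_n ∫_{|u^n| ≥ c} |u^n|^p → 0` as `c → ∞`.
The suprema are taken in `[0, ∞]`. -/
structure LpUniformlyIntegrable {X : Type*} [MeasurableSpace X] (μ : Measure X) (p : ℝ)
    (u : ℕ → X → ℝ) : Prop where
  aestronglyMeasurable : ∀ n, AEStronglyMeasurable (u n) μ
  bounded : ⨆ n, ∫⁻ z, ENNReal.ofReal (|u n z| ^ p) ∂μ < ⊤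
  tail : Tendsto
    (fun c : ℝ => ⨆ n, ∫⁻ z in {z | c ≤ |u n z|}, ENNReal.ofReal (|u n z| ^ p) ∂μ)
    atTop (𝓝 0)

/-- Weak-⋆ convergence in `L^∞(μ)`, tested against `L^1(μ)`. -/
structure TendstoWeakStarLinfty {X : Type*} [MeasurableSpace X] (μ : Measure X)
    (f : ℕ → X → ℝ) (F : X → ℝ) : Prop where
  memLp : ∀ n, MemLp (f n) ⊤ μ
  memLp_limit : MemLp F ⊤ μ
  tendsto : ∀ ψ : X → ℝ, Integrable ψ μ →
    Tendsto (fun n => ∫ z, f n z * ψ z ∂μ) atTop (𝓝 (∫ z, F z * ψ z ∂μ))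

/-- Weak convergence in `L^1(μ)`, tested against `L^∞(μ)`. -/
structure TendstoWeaklyL1 {X : Type*} [MeasurableSpace X] (μ : Measure X)
    (f : ℕ → X → ℝ) (F : X → ℝ) : Prop where
  integrable : ∀ n, Integrable (f n) μ
  integrable_limit : Integrable F μ
  tendsto : ∀ ψ : X → ℝ, MemLp ψ ⊤ μ →
    Tendsto (fun n => ∫ z, f n z * ψ z ∂μ) atTop (𝓝 (∫ z, F z * ψ z ∂μ))

/-- The kinetic function: `1_{0 < ξ < u}` for `u > 0`, `-1_{u < ξ < 0}` for `u < 0`,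
and `0` for `u = 0`. -/
def kineticFunction (ξ u : ℝ) : ℝ :=
  if 0 < ξ ∧ ξ < u then 1 else if u < ξ ∧ ξ < 0 then -1 else 0

/-- `ν` is the Young measure generated by the (whole) sequence `u`: a weakly-⋆ measurable
family of probability measures on `ℝ`, defined up to null sets, such that
`f(u^n) ⇀ ∫ f dν_z` weak-⋆ in `L^∞(μ)` for every `f ∈ C_0(ℝ)`; the measurability of
`z ↦ ∫ f dν_z` is contained in `TendstoWeakStarLinfty.memLp_limit`. -/
structure IsYoungMeasure {X : Type*} [MeasurableSpace X] (μ : Measure X)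
    (u : ℕ → X → ℝ) (ν : X → Measure ℝ) : Prop where
  isProbabilityMeasure : ∀ᵐ z ∂μ, IsProbabilityMeasure (ν z)
  tendsto : ∀ f : ℝ → ℝ, Continuous f → Tendsto f (cocompact ℝ) (𝓝 0) →
    TendstoWeakStarLinfty μ (fun n z => f (u n z)) (fun z => ∫ ξ, f ξ ∂(ν z))

end

/-!
The identity `S v = S 0 + ∫ S'(ξ) χ(ξ, v) dξ` (`integral_mul_kineticFunction` and the fundamental
theorem of calculus for absolutely continuous functions) turns the nonlinear expression `S (u n)`
into a linear one in `χ(ξ, u n)`. Testing it with a bounded `ψ(z)` amounts to testing the weak-⋆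
convergence of `χ(ξ, u n)` with `S'(ξ) ψ(z)`, which is integrable only for `ξ` in bounded sets. The
remaining part `|ξ| > R` is at most a constant times the integral of `|u n| ^ p` over
`{|u n| ≥ R}` (`lintegral_mul_kineticFunction_tail_le`), hence small uniformly in `n`. By
`TendstoWeakStarLinfty.tendsto_integral_mul_of_tail` such a uniform tail bound makes
`S'(ξ) ψ(z) g(z, ξ)` integrable and lets the two limits be exchanged; Fubini's theorem then gives the
weak limit of `S (u n)` in terms of `g`.

For the Young measure, `S` is multiplied by cutoffs. The uniform `L^1` bound on `S (u n)` and
Fatou's lemma show that the moments of `|S|` under `ν z` are integrable in `z`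
(`IsYoungMeasure.exists_integrable_bound`), and the same exchange of limits gives
`S (u n) ⇀ ∫ S dν` weakly in `L^1` (`IsYoungMeasure.tendstoWeaklyL1_comp`). The two formulas for the
weak limit agree almost everywhere because weak limits in `L^1` are unique.
-/

open scoped ENNReal

/-! ### Weak limits tested against unbounded weights -/

/-- The form in which the exchange of the truncation limit `k → ∞` with the weak limit `n → ∞` is
justified. -/
lemma tendstoUniformly_integral_of_enorm_le {Y : Type*} [MeasurableSpace Y] {m : Measure Y}
    {F : ℕ → ℕ → Y → ℝ} {f : ℕ → Y → ℝ} (hF : ∀ k n, Integrable (F k n) m)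
    (hf : ∀ n, Integrable (f n) m) {t : ℕ → ℝ≥0∞} (ht : Tendsto t atTop (𝓝 0))
    (h : ∀ k n, ∫⁻ y, ‖f n y - F k n y‖ₑ ∂m ≤ t k) :
    TendstoUniformly (fun k n => ∫ y, F k n y ∂m) (fun n => ∫ y, f n y ∂m) atTop := by
  rw [Metric.tendstoUniformly_iff]
  intro ε hε
  filter_upwards [ht.eventually_lt_const (ENNReal.ofReal_pos.2 hε)] with k hk n
  rw [← edist_lt_ofReal, edist_eq_enorm_sub, ← integral_sub (hf n) (hF k n)]
  exact ((enorm_integral_le_lintegral_enorm _).trans (h k n)).trans_lt hk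

/-- Weak-⋆ convergence in `L^∞` extends from integrable test functions to locally integrable weights
`W`, provided the mass of `W * f n` outside the exhausting sets `B k` is small uniformly in `n`. -/
theorem TendstoWeakStarLinfty.tendsto_integral_mul_of_tail {Y : Type*} [MeasurableSpace Y]
    {m : Measure Y} {f : ℕ → Y → ℝ} {F : Y → ℝ} (hf : TendstoWeakStarLinfty m f F)
    (hf1 : ∀ n y, |f n y| ≤ 1) {W : Y → ℝ} (hW : AEStronglyMeasurable W m)
    {B : ℕ → Set Y} (hB : AECover m atTop B) (hWB : ∀ k, IntegrableOn W (B k) m)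
    {t : ℕ → ℝ≥0∞} (ht : Tendsto t atTop (𝓝 0))
    (htail : ∀ k n, ∫⁻ y in (B k)ᶜ, ‖W y * f n y‖ₑ ∂m ≤ t k) :
    Integrable (fun y => W y * F y) m ∧ (∀ n, Integrable (fun y => W y * f n y) m) ∧
      Tendsto (fun n => ∫ y, W y * f n y ∂m) atTop (𝓝 (∫ y, W y * F y ∂m)) := by
  -- All `W * f n` have `L^1` norm at most `M`: inside `B k₀` because `|f n| ≤ 1`, outside by the
  -- tail bound.
  obtain ⟨k₀, hk₀⟩ := (ht.eventually_lt_const (ENNReal.zero_lt_top)).exists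
  set M : ℝ≥0∞ := ∫⁻ y in B k₀, ‖W y‖ₑ ∂m + t k₀ with hM
  have hMtop : M ≠ ⊤ := ENNReal.add_ne_top.2 ⟨(hWB k₀).2.ne, hk₀.ne⟩
  have hbound : ∀ n, ∫⁻ y, ‖W y * f n y‖ₑ ∂m ≤ M := fun n => by
    rw [← lintegral_add_compl _ (hB.measurableSet k₀)]
    refine add_le_add (lintegral_mono fun y => ?_) (htail k₀ n)
    rw [enorm_le_iff_norm_le, norm_mul]
    exact mul_le_of_le_one_right (norm_nonneg _) (hf1 n y)
  have hint : ∀ n, Integrable (fun y => W y * f n y) m := fun n =>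
    ⟨hW.mul (hf.memLp n).1, (hbound n).trans_lt hMtop.lt_top⟩
  have hFB : ∀ k, IntegrableOn (fun y => W y * F y) (B k) m := fun k =>
    (hWB k).mul_of_top_left (hf.memLp_limit.restrict (B k))
  have hind : ∀ k (G : Y → ℝ), ∫ y, G y * (B k).indicator W y ∂m = ∫ y in B k, W y * G y ∂m :=
    fun k G => by
      rw [← integral_indicator (hB.measurableSet k)]
      refine integral_congr_ae (.of_forall fun y => ?_)
      by_cases hy : y ∈ B k <;> simp [hy, mul_comm]
  have hFint : Integrable (fun y => W y * F y) m := by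
    refine hB.integrable_of_integral_norm_bounded M.toReal hFB (.of_forall fun k => ?_)
    -- Testing the convergence against `sign (W F) W` on `B k` recovers the integral of `|W F|`.
    set s : Y → ℝ := fun y => (SignType.sign (W y * F y) : ℝ) with hs
    have hsm : AEStronglyMeasurable s m := by
      have : Measurable fun x : ℝ => ((SignType.sign x : SignType) : ℝ) := by
        have h0 : (fun x : ℝ => ((SignType.sign x : SignType) : ℝ)) =
            fun x => if 0 < x then 1 else if x < 0 then -1 else 0 := by
          ext x
          rw [sign_apply]
          split_ifs <;> simp
        rw [h0]
        exact Measurable.ite measurableSet_Ioi measurable_const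
          (Measurable.ite measurableSet_Iio measurable_const measurable_const)
      exact (this.comp_aemeasurable
        (hW.mul hf.memLp_limit.1).aemeasurable).aestronglyMeasurable
    have hs1 : ∀ y, ‖s y‖ ≤ 1 := fun y => by
      rcases lt_trichotomy (W y * F y) 0 with h | h | h <;> simp [hs, h]
    have key := hf.tendsto ((B k).indicator fun y => s y * W y)
      ((integrable_indicator_iff (hB.measurableSet k)).2
        ((hWB k).bdd_mul hsm.restrict (.of_forall hs1)))
    have heq : ∫ y, F y * (B k).indicator (fun y => s y * W y) y ∂m
        = ∫ y in B k, ‖W y * F y‖ ∂m := by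
      rw [← integral_indicator (hB.measurableSet k)]
      refine integral_congr_ae (.of_forall fun y => ?_)
      by_cases hy : y ∈ B k
      · simp only [hy, Set.indicator_of_mem, hs, Real.norm_eq_abs, ← sign_mul_self]
        ring
      · simp [hy]
    rw [heq] at key
    refine le_of_tendsto key (.of_forall fun n => ?_)
    refine (le_abs_self _).trans ?_
    rw [← Real.norm_eq_abs, ← toReal_enorm]
    refine ENNReal.toReal_mono hMtop ((enorm_integral_le_lintegral_enorm _).trans
      ((lintegral_mono fun y => ?_).trans (hbound n)))
    rw [enorm_le_iff_norm_le]
    by_cases hy : y ∈ B k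
    · simp only [hy, Set.indicator_of_mem, norm_mul]
      nlinarith [hs1 y, norm_nonneg (f n y), norm_nonneg (W y),
        mul_nonneg (norm_nonneg (f n y)) (norm_nonneg (W y))]
    · simpa [hy] using mul_nonneg (abs_nonneg _) (abs_nonneg _)
  refine ⟨hFint, hint, ?_⟩
  have hu := tendstoUniformly_integral_of_enorm_le
    (F := fun k n => (B k).indicator fun y => W y * f n y)
    (fun k n => (hint n).indicator (hB.measurableSet k)) hint ht (fun k n => by
      refine le_trans (le_of_eq ?_) (htail k n)
      rw [← lintegral_indicator (hB.measurableSet k).compl]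
      refine lintegral_congr fun y => ?_
      by_cases hy : y ∈ B k <;> simp [hy])
  refine hu.tendsto_of_eventually_tendsto (.of_forall fun k => ?_)
    (hB.integral_tendsto_of_countably_generated hFint)
  have := hf.tendsto ((B k).indicator W) ((hWB k).integrable_indicator (hB.measurableSet k))
  simp only [hind] at this
  simpa only [integral_indicator (hB.measurableSet k)] using this

theorem TendstoWeaklyL1.limit_ae_unique {X : Type*} [MeasurableSpace X] {μ : Measure X}
    {f : ℕ → X → ℝ} {F G : X → ℝ} (hF : TendstoWeaklyL1 μ f F) (hG : TendstoWeaklyL1 μ f G) :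
    F =ᵐ[μ] G := by
  refine hF.integrable_limit.ae_eq_of_forall_setIntegral_eq F G hG.integrable_limit
    fun s hs _ => ?_
  have h1 : MemLp (s.indicator fun _ => (1 : ℝ)) ⊤ μ := (memLp_top_const 1).indicator hs
  have h2 : ∀ H : X → ℝ, ∫ z, H z * s.indicator (fun _ => (1 : ℝ)) z ∂μ = ∫ z in s, H z ∂μ :=
    fun H => by
      rw [← integral_indicator hs]
      refine integral_congr_ae (.of_forall fun z => ?_)
      by_cases hz : z ∈ s <;> simp [hz]
  have := tendsto_nhds_unique (hF.tendsto _ h1) (hG.tendsto _ h1)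
  rwa [h2, h2] at this

/-! ### The kinetic function -/

lemma abs_kineticFunction_le_one (ξ v : ℝ) : |kineticFunction ξ v| ≤ 1 := by
  unfold kineticFunction
  split_ifs <;> simp

lemma kineticFunction_eq_zero_of_abs_le {ξ v : ℝ} (h : |v| ≤ |ξ|) : kineticFunction ξ v = 0 := by
  unfold kineticFunction
  rw [if_neg, if_neg]
  · rintro ⟨h1, h2⟩
    rw [abs_of_neg h2, abs_of_neg (h1.trans h2)] at h
    linarith
  · rintro ⟨h1, h2⟩
    rw [abs_of_pos h1, abs_of_pos (h1.trans h2)] at h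
    linarith

/-- The kinetic function represents integration from `0` to `v`, orientation included. -/
lemma integral_mul_kineticFunction (h : ℝ → ℝ) (v : ℝ) :
    ∫ ξ, h ξ * kineticFunction ξ v = ∫ ξ in (0 : ℝ)..v, h ξ := by
  rcases le_total 0 v with hv | hv
  · rw [intervalIntegral.integral_of_le hv, integral_Ioc_eq_integral_Ioo,
      ← integral_indicator measurableSet_Ioo]
    refine integral_congr_ae (.of_forall fun ξ => ?_)
    have h2 : ¬ (v < ξ ∧ ξ < 0) := fun h => by linarith [h.1, h.2]
    by_cases hξ : 0 < ξ ∧ ξ < v <;> simp [kineticFunction, Set.indicator, hξ, h2]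
  · rw [intervalIntegral.integral_of_ge hv, integral_Ioc_eq_integral_Ioo,
      ← integral_indicator measurableSet_Ioo, ← integral_neg]
    refine integral_congr_ae (.of_forall fun ξ => ?_)
    have h2 : ¬ (0 < ξ ∧ ξ < v) := fun h => by linarith [h.1, h.2]
    by_cases hξ : v < ξ ∧ ξ < 0 <;> simp [kineticFunction, Set.indicator, hξ, h2]

lemma rpow_sub_one_mul_self {x p : ℝ} (hx : 0 ≤ x) (hp : 1 ≤ p) : x ^ (p - 1) * x = x ^ p := by
  rcases hx.eq_or_lt with rfl | hx
  · simp [Real.zero_rpow (show p ≠ 0 by linarith)]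
  · rw [← Real.rpow_add_one hx.ne', sub_add_cancel]

/-- At height `|ξ| > R ≥ 1` the weight `h` sees the kinetic function of `v` only if `|v| > R`,
and then its contribution is of order `|v| ^ p`. -/
lemma lintegral_mul_kineticFunction_tail_le {h : ℝ → ℝ} {p C R : ℝ} (hp : 1 ≤ p) (hC : 0 ≤ C)
    (hR : 1 ≤ R) (hh : ∀ᵐ ξ : ℝ, |h ξ| ≤ C * (|ξ| ^ (p - 1) + 1)) (v : ℝ) :
    ∫⁻ ξ in (Set.Icc (-R) R)ᶜ, ‖h ξ * kineticFunction ξ v‖ₑ ≤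
      ENNReal.ofReal (4 * C) *
        {w : ℝ | R ≤ |w|}.indicator (fun w => ENNReal.ofReal (|w| ^ p)) v := by
  by_cases hv : R ≤ |v|
  · rw [Set.indicator_of_mem (by exact hv), ← ENNReal.ofReal_mul (by positivity)]
    calc ∫⁻ ξ in (Set.Icc (-R) R)ᶜ, ‖h ξ * kineticFunction ξ v‖ₑ
        ≤ ∫⁻ ξ, ‖h ξ * kineticFunction ξ v‖ₑ := setLIntegral_le_lintegral _ _
      _ ≤ ∫⁻ ξ, (Set.Icc (-|v|) |v|).indicator
            (fun _ => ENNReal.ofReal (2 * C * |v| ^ (p - 1))) ξ := by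
          refine lintegral_mono_ae ?_
          filter_upwards [hh] with ξ hξ
          by_cases hm : ξ ∈ Set.Icc (-|v|) |v|
          · rw [Set.indicator_of_mem hm, ← ofReal_norm, norm_mul]
            have h1 : |ξ| ^ (p - 1) ≤ |v| ^ (p - 1) :=
              Real.rpow_le_rpow (abs_nonneg _) (abs_le.2 hm) (by linarith)
            have h2 : 1 ≤ |v| ^ (p - 1) := Real.one_le_rpow (hR.trans hv) (by linarith)
            refine ENNReal.ofReal_le_ofReal
              ((mul_le_of_le_one_right (norm_nonneg _) (abs_kineticFunction_le_one ξ v)).trans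
              (hξ.trans ?_))
            nlinarith
          · rw [kineticFunction_eq_zero_of_abs_le]
            · simp
            · exact (not_le.1 fun hle => hm (abs_le.1 hle)).le
      _ = ENNReal.ofReal (4 * C * |v| ^ p) := by
          rw [lintegral_indicator_const measurableSet_Icc, Real.volume_Icc,
            ← ENNReal.ofReal_mul (by positivity), ← rpow_sub_one_mul_self (abs_nonneg v) hp]
          congr 1
          ring
  · refine (le_of_eq ?_).trans zero_le
    rw [← lintegral_zero (μ := volume.restrict (Set.Icc (-R) R)ᶜ)]
    refine setLIntegral_congr_fun measurableSet_Icc.compl fun ξ hξ => ?_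
    have : R < |ξ| := not_le.1 fun hle => hξ (abs_le.1 hle)
    simp [kineticFunction_eq_zero_of_abs_le ((not_le.1 hv).trans this).le]

/-! ### Weak limits through the kinetic function -/

lemma LpUniformlyIntegrable.tendsto_tail_nat {X : Type*} [MeasurableSpace X] {μ : Measure X}
    {p : ℝ} {u : ℕ → X → ℝ} (hu : LpUniformlyIntegrable μ p u) {R : ℕ → ℝ}
    (hR : Tendsto R atTop atTop) {c : ℝ≥0∞} (hc : c ≠ ⊤) :
    Tendsto (fun k => c * ⨆ n, ∫⁻ z in {z | R k ≤ |u n z|}, ENNReal.ofReal (|u n z| ^ p) ∂μ)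
      atTop (𝓝 0) := by
  simpa using ENNReal.Tendsto.const_mul (hu.tail.comp hR) (.inr hc)

lemma nullMeasurableSet_le_abs {X : Type*} [MeasurableSpace X] {μ : Measure X} {v : X → ℝ}
    (hv : AEStronglyMeasurable v μ) (R : ℝ) : NullMeasurableSet {z | R ≤ |v z|} μ :=
  nullMeasurableSet_le aemeasurable_const hv.norm.aemeasurable

section Kinetic

variable {X : Type*} [MeasurableSpace X] {μ : Measure X} [IsFiniteMeasure μ] {p C : ℝ}
  {u : ℕ → X → ℝ} {g : X → ℝ → ℝ} {h : ℝ → ℝ}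

/-- The weak-⋆ convergence of the kinetic functions may be tested against `h(ξ) ψ(z)` with `h` of
growth `p - 1` and `ψ` bounded. -/
theorem LpUniformlyIntegrable.tendsto_integral_prod_mul_kineticFunction
    (hp : 1 ≤ p) (hC : 0 ≤ C) (hu : LpUniformlyIntegrable μ p u)
    (hg : TendstoWeakStarLinfty (μ.prod (volume : Measure ℝ))
      (fun n w => kineticFunction w.2 (u n w.1)) (fun w => g w.1 w.2))
    (hm : Measurable h) (hh : ∀ᵐ ξ : ℝ, |h ξ| ≤ C * (|ξ| ^ (p - 1) + 1))
    {ψ : X → ℝ} (hψ : MemLp ψ ⊤ μ) :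
    Integrable (fun w : X × ℝ => h w.2 * ψ w.1 * g w.1 w.2) (μ.prod volume) ∧
    (∀ n, Integrable (fun w : X × ℝ => h w.2 * ψ w.1 * kineticFunction w.2 (u n w.1))
      (μ.prod volume)) ∧
    Tendsto (fun n => ∫ w : X × ℝ, h w.2 * ψ w.1 * kineticFunction w.2 (u n w.1) ∂(μ.prod volume))
      atTop (𝓝 (∫ w : X × ℝ, h w.2 * ψ w.1 * g w.1 w.2 ∂(μ.prod volume))) := by
  have hR : Tendsto (fun k : ℕ => (k : ℝ) + 1) atTop atTop :=
    tendsto_atTop_add_const_right _ _ tendsto_natCast_atTop_atTop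
  have hWm : AEStronglyMeasurable (fun w : X × ℝ => h w.2 * ψ w.1) (μ.prod volume) :=
    (hm.aestronglyMeasurable.comp_snd).mul hψ.1.comp_fst
  refine hg.tendsto_integral_mul_of_tail (W := fun w => h w.2 * ψ w.1)
    (fun n y => abs_kineticFunction_le_one _ _) hWm
    (B := fun k : ℕ => Set.univ ×ˢ Set.Icc (-((k : ℝ) + 1)) (k + 1)) ?_ (fun k => ?_)
    (hu.tendsto_tail_nat hR (c := eLpNormEssSup ψ μ * ENNReal.ofReal (4 * C)) ?_)
    (fun k n => ?_)
  · refine ⟨.of_forall fun w => ?_, fun k => MeasurableSet.univ.prod measurableSet_Icc⟩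
    filter_upwards [hR.eventually_ge_atTop |w.2|] with k hk
    exact ⟨trivial, abs_le.1 hk⟩
  · rw [IntegrableOn, ← Measure.prod_restrict, Measure.restrict_univ]
    refine Integrable.congr (Integrable.mul_prod (hψ.integrable le_top)
      (g := h) ?_) (.of_forall fun w => mul_comm _ _)
    refine Measure.integrableOn_of_bounded (M := C * (((k : ℝ) + 1) ^ (p - 1) + 1))
      (by simp) hm.aestronglyMeasurable ?_
    filter_upwards [ae_restrict_of_ae hh, ae_restrict_mem measurableSet_Icc] with ξ h1 h2
    refine h1.trans ?_
    gcongr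
    exact abs_le.2 h2
  · refine ENNReal.mul_ne_top ?_ ENNReal.ofReal_ne_top
    rw [← eLpNorm_exponent_top]
    exact hψ.2.ne
  · have hc : (Set.univ ×ˢ Set.Icc (-((k : ℝ) + 1)) (k + 1) : Set (X × ℝ))ᶜ
        = Set.univ ×ˢ (Set.Icc (-((k : ℝ) + 1)) (k + 1))ᶜ := by
      ext w; simp
    have hk1 : (1 : ℝ) ≤ k + 1 := by linarith [k.cast_nonneg (α := ℝ)]
    rw [hc, ← Measure.prod_restrict, Measure.restrict_univ, lintegral_prod]
    · calc _ ≤ ∫⁻ z, eLpNormEssSup ψ μ * ENNReal.ofReal (4 * C) *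
              {z | (k : ℝ) + 1 ≤ |u n z|}.indicator
                (fun z => ENNReal.ofReal (|u n z| ^ p)) z ∂μ := by
            refine lintegral_mono_ae ?_
            filter_upwards [enorm_ae_le_eLpNormEssSup ψ μ] with z hz
            have h1 := lintegral_mul_kineticFunction_tail_le hp hC hk1 hh (u n z)
            calc _ = ∫⁻ ξ in (Set.Icc (-((k : ℝ) + 1)) (k + 1))ᶜ,
                    ‖ψ z‖ₑ * ‖h ξ * kineticFunction ξ (u n z)‖ₑ := by
                  refine lintegral_congr fun ξ => ?_
                  rw [← enorm_mul]
                  congr 1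
                  ring
              _ = ‖ψ z‖ₑ * _ := lintegral_const_mul' _ _ enorm_ne_top
              _ ≤ _ := by
                  rw [mul_assoc]
                  exact mul_le_mul' hz h1
        _ = eLpNormEssSup ψ μ * ENNReal.ofReal (4 * C) *
              ∫⁻ z in {z | (k : ℝ) + 1 ≤ |u n z|}, ENNReal.ofReal (|u n z| ^ p) ∂μ := by
            rw [lintegral_const_mul', lintegral_indicator₀
              (nullMeasurableSet_le_abs (hu.aestronglyMeasurable n) _)]
            refine ENNReal.mul_ne_top ?_ ENNReal.ofReal_ne_top
            rw [← eLpNorm_exponent_top]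
            exact hψ.2.ne
        _ ≤ _ := by
            gcongr
            exact le_iSup (fun n => ∫⁻ z in {z | (k : ℝ) + 1 ≤ |u n z|},
              ENNReal.ofReal (|u n z| ^ p) ∂μ) n
    · have : μ.prod (volume.restrict (Set.Icc (-((k : ℝ) + 1)) (k + 1))ᶜ) ≤ μ.prod volume := by
        have := Measure.restrict_le_self (μ := μ.prod volume)
          (s := Set.univ ×ˢ (Set.Icc (-((k : ℝ) + 1)) (k + 1))ᶜ)
        rwa [← Measure.prod_restrict, Measure.restrict_univ] at this
      exact ((hWm.mul (hg.memLp n).1).mono_measure this).enorm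

/-- The weak limit of `S (u n)` is read off from the weak-⋆ limit of the kinetic functions, because
`S v = S 0 + ∫ S'(ξ) χ(ξ, v) dξ`. -/
theorem LpUniformlyIntegrable.tendstoWeaklyL1_of_kineticFunction
    (hp : 1 ≤ p) (hC : 0 ≤ C) (hu : LpUniformlyIntegrable μ p u)
    (hg : TendstoWeakStarLinfty (μ.prod (volume : Measure ℝ))
      (fun n w => kineticFunction w.2 (u n w.1)) (fun w => g w.1 w.2))
    {S : ℝ → ℝ} (hS : ∀ v, AbsolutelyContinuousOnInterval S 0 v)
    (hSC : ∀ᵐ ξ : ℝ, |deriv S ξ| ≤ C * (|ξ| ^ (p - 1) + 1)) :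
    (∀ᵐ z ∂μ, Integrable (fun ξ : ℝ => deriv S ξ * g z ξ)) ∧
    TendstoWeaklyL1 μ (fun n z => S (u n z)) (fun z => S 0 + ∫ ξ : ℝ, deriv S ξ * g z ξ) := by
  have key := fun (ψ : X → ℝ) (hψ : MemLp ψ ⊤ μ) =>
    hu.tendsto_integral_prod_mul_kineticFunction hp hC hg (measurable_deriv S) hSC hψ
  obtain ⟨h1, h2, -⟩ := key (fun _ => 1) (memLp_top_const 1)
  simp only [mul_one] at h1 h2
  have hrep : ∀ v, ∫ ξ, deriv S ξ * kineticFunction ξ v = S v - S 0 := fun v => by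
    rw [integral_mul_kineticFunction, (hS v).integral_deriv_eq_sub]
  have hgi : Integrable (fun z => ∫ ξ, deriv S ξ * g z ξ) μ := h1.integral_prod_left
  have hui : ∀ n, Integrable (fun z => S (u n z)) μ := fun n => by
    have := (h2 n).integral_prod_left.add (integrable_const (S 0))
    refine this.congr (.of_forall fun z => ?_)
    simp [hrep]
  refine ⟨h1.prod_right_ae, hui, (integrable_const _).add hgi, fun ψ hψ => ?_⟩
  obtain ⟨k1, k2, k3⟩ := key ψ hψ
  have hψi : Integrable ψ μ := hψ.integrable le_top
  have e1 : ∀ n, ∫ z, S (u n z) * ψ z ∂μ = ∫ z, S 0 * ψ z ∂μ +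
      ∫ w : X × ℝ, deriv S w.2 * ψ w.1 * kineticFunction w.2 (u n w.1) ∂(μ.prod volume) := by
    intro n
    rw [integral_prod _ (k2 n), ← integral_add (hψi.const_mul _) (k2 n).integral_prod_left]
    refine integral_congr_ae (.of_forall fun z => ?_)
    have : ∀ ξ, deriv S ξ * ψ z * kineticFunction ξ (u n z) =
      deriv S ξ * kineticFunction ξ (u n z) * ψ z := fun ξ => by ring
    simp only [this, integral_mul_const, hrep]
    ring
  have e2 : ∫ z, (S 0 + ∫ ξ, deriv S ξ * g z ξ) * ψ z ∂μ = ∫ z, S 0 * ψ z ∂μ +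
      ∫ w : X × ℝ, deriv S w.2 * ψ w.1 * g w.1 w.2 ∂(μ.prod volume) := by
    rw [integral_prod _ k1, ← integral_add (hψi.const_mul _) k1.integral_prod_left]
    refine integral_congr_ae (.of_forall fun z => ?_)
    have : ∀ ξ, deriv S ξ * ψ z * g z ξ = deriv S ξ * g z ξ * ψ z := fun ξ => by ring
    simp only [this, integral_mul_const]
    ring
  simp only [e1, e2]
  exact k3.const_add _

end Kinetic

/-! ### Young measures and functions of polynomial growth -/

/-- The continuous cutoff which is `1` for `|ξ| ≤ k`, `0` for `|ξ| ≥ k + 1`, and affine in `|ξ|`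
in between. -/
def cutoff (k : ℕ) (ξ : ℝ) : ℝ := max 0 (min 1 (k + 1 - |ξ|))

lemma continuous_cutoff (k : ℕ) : Continuous (cutoff k) := by
  unfold cutoff
  fun_prop

lemma cutoff_nonneg (k : ℕ) (ξ : ℝ) : 0 ≤ cutoff k ξ := le_max_left _ _

lemma cutoff_le_one (k : ℕ) (ξ : ℝ) : cutoff k ξ ≤ 1 :=
  max_le zero_le_one (min_le_left _ _)

lemma cutoff_eq_one {k : ℕ} {ξ : ℝ} (h : |ξ| ≤ k) : cutoff k ξ = 1 := by
  rw [cutoff, min_eq_left (by linarith), max_eq_right zero_le_one]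

lemma cutoff_eq_zero {k : ℕ} {ξ : ℝ} (h : (k : ℝ) + 1 ≤ |ξ|) : cutoff k ξ = 0 := by
  rw [cutoff, max_eq_left]
  exact (min_le_right _ _).trans (by linarith)

lemma eventually_cutoff_eq_one (ξ : ℝ) : ∀ᶠ k in atTop, cutoff k ξ = 1 := by
  filter_upwards [tendsto_natCast_atTop_atTop.eventually_ge_atTop |ξ|] with k hk
  exact cutoff_eq_one hk

lemma hasCompactSupport_mul_cutoff (f : ℝ → ℝ) (k : ℕ) :
    HasCompactSupport (fun ξ => f ξ * cutoff k ξ) := by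
  refine HasCompactSupport.intro (isCompact_Icc (a := -((k : ℝ) + 1)) (b := k + 1)) fun ξ hξ => ?_
  rw [cutoff_eq_zero (not_le.1 fun h => hξ (abs_le.1 h)).le, mul_zero]

section YoungMeasure

variable {X : Type*} [MeasurableSpace X] {μ : Measure X} {p A : ℝ}
  {u : ℕ → X → ℝ} {ν : X → Measure ℝ} {S : ℝ → ℝ}

/-- Cutting off a function of growth `p` at height `k + 1` costs, uniformly along the sequence, at
most the `L^p` mass above that height. -/
lemma LpUniformlyIntegrable.lintegral_comp_sub_cutoff_le (hu : LpUniformlyIntegrable μ p u)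
    (hp : 0 ≤ p) (hA : 0 ≤ A) (hSA : ∀ ξ, |S ξ| ≤ A * (1 + |ξ| ^ p))
    {ψ : X → ℝ} (k n : ℕ) :
    ∫⁻ z, ‖S (u n z) * ψ z - S (u n z) * cutoff (k + 1) (u n z) * ψ z‖ₑ ∂μ ≤
      eLpNormEssSup ψ μ * ENNReal.ofReal (2 * A) *
        ⨆ n, ∫⁻ z in {z | (k : ℝ) + 1 ≤ |u n z|}, ENNReal.ofReal (|u n z| ^ p) ∂μ := by
  calc _ ≤ ∫⁻ z, eLpNormEssSup ψ μ * ({z | (k : ℝ) + 1 ≤ |u n z|}.indicator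
            (fun z => ENNReal.ofReal (2 * A) * ENNReal.ofReal (|u n z| ^ p)) z) ∂μ := by
        refine lintegral_mono_ae ?_
        filter_upwards [enorm_ae_le_eLpNormEssSup ψ μ] with z hz
        have e : S (u n z) * ψ z - S (u n z) * cutoff (k + 1) (u n z) * ψ z =
          ψ z * (S (u n z) * (1 - cutoff (k + 1) (u n z))) := by ring
        rw [e, enorm_mul]
        refine mul_le_mul' hz ?_
        by_cases h : (k : ℝ) + 1 ≤ |u n z|
        · rw [Set.indicator_of_mem (by exact h), ← ENNReal.ofReal_mul (by positivity),
            ← ofReal_norm, norm_mul]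
          refine ENNReal.ofReal_le_ofReal ?_
          have h1 : ‖1 - cutoff (k + 1) (u n z)‖ ≤ 1 := by
            rw [Real.norm_eq_abs, abs_le]
            constructor <;> linarith [cutoff_nonneg (k + 1) (u n z), cutoff_le_one (k + 1) (u n z)]
          have h2 : 1 ≤ |u n z| ^ p :=
            Real.one_le_rpow (by linarith [k.cast_nonneg (α := ℝ)]) hp
          refine (mul_le_of_le_one_right (norm_nonneg _) h1).trans ((hSA _).trans ?_)
          nlinarith
        · rw [cutoff_eq_one (by push_cast; exact (not_le.1 h).le)]
          simp
    _ ≤ eLpNormEssSup ψ μ * (ENNReal.ofReal (2 * A) *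
          ∫⁻ z in {z | (k : ℝ) + 1 ≤ |u n z|}, ENNReal.ofReal (|u n z| ^ p) ∂μ) := by
        rw [lintegral_const_mul'', lintegral_indicator₀, lintegral_const_mul' _ _
          ENNReal.ofReal_ne_top]
        · exact nullMeasurableSet_le_abs (hu.aestronglyMeasurable n) _
        · refine AEMeasurable.indicator₀ ?_
            (nullMeasurableSet_le_abs (hu.aestronglyMeasurable n) _)
          exact (((hu.aestronglyMeasurable n).norm.aemeasurable.pow_const p).ennreal_ofReal).const_mul
            _
    _ ≤ _ := by
        rw [mul_assoc]
        gcongr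
        exact le_iSup (fun n => ∫⁻ z in {z | (k : ℝ) + 1 ≤ |u n z|},
              ENNReal.ofReal (|u n z| ^ p) ∂μ) n

lemma integrable_mul_cutoff (hS : Continuous S) (k : ℕ) (ρ : Measure ℝ) [IsFiniteMeasure ρ] :
    Integrable (fun ξ => S ξ * cutoff k ξ) ρ :=
  (hS.mul (continuous_cutoff k)).integrable_of_hasCompactSupport
    (hasCompactSupport_mul_cutoff S k)

lemma IsYoungMeasure.tendsto_cutoff (hν : IsYoungMeasure μ u ν) (hS : Continuous S) (k : ℕ) :
    TendstoWeakStarLinfty μ (fun n z => S (u n z) * cutoff k (u n z))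
      (fun z => ∫ ξ, S ξ * cutoff k ξ ∂(ν z)) :=
  hν.tendsto _ (hS.mul (continuous_cutoff k))
    (tendsto_const_nhds.congr' (by
      have := hasCompactSupport_iff_eventuallyEq.1 (hasCompactSupport_mul_cutoff S k)
      rw [coclosedCompact_eq_cocompact] at this
      exact this.symm))

variable [IsFiniteMeasure μ]

lemma LpUniformlyIntegrable.exists_lintegral_comp_le (hu : LpUniformlyIntegrable μ p u)
    (hA : 0 ≤ A) (hSA : ∀ ξ, |S ξ| ≤ A * (1 + |ξ| ^ p)) :
    ∃ M : ℝ≥0∞, M ≠ ⊤ ∧ ∀ n, ∫⁻ z, ‖S (u n z)‖ₑ ∂μ ≤ M := by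
  refine ⟨ENNReal.ofReal A * (μ Set.univ + ⨆ n, ∫⁻ z, ENNReal.ofReal (|u n z| ^ p) ∂μ),
    ENNReal.mul_ne_top ENNReal.ofReal_ne_top
      (ENNReal.add_ne_top.2 ⟨measure_ne_top _ _, hu.bounded.ne⟩), fun n => ?_⟩
  calc ∫⁻ z, ‖S (u n z)‖ₑ ∂μ
      ≤ ∫⁻ z, ENNReal.ofReal A * (1 + ENNReal.ofReal (|u n z| ^ p)) ∂μ := by
        refine lintegral_mono fun z => ?_
        rw [← ENNReal.ofReal_one, ← ENNReal.ofReal_add zero_le_one (by positivity),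
          ← ENNReal.ofReal_mul hA, ← ofReal_norm]
        exact ENNReal.ofReal_le_ofReal (hSA _)
    _ = ENNReal.ofReal A * (μ Set.univ + ∫⁻ z, ENNReal.ofReal (|u n z| ^ p) ∂μ) := by
        rw [lintegral_const_mul' _ _ ENNReal.ofReal_ne_top,
          lintegral_add_left measurable_const, lintegral_const, one_mul]
    _ ≤ _ := by
        gcongr
        exact le_iSup (fun n => ∫⁻ z, ENNReal.ofReal (|u n z| ^ p) ∂μ) n

/-- A uniform `L^1` bound on `S (u n)` passes to the cut-off moments of the Young measure, since
these are weak limits of `|S (u n)|` times a cutoff. -/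
lemma IsYoungMeasure.lintegral_lintegral_cutoff_le (hν : IsYoungMeasure μ u ν)
    (hS : Continuous S) {M : ℝ≥0∞} (hM : M ≠ ⊤) (hSM : ∀ n, ∫⁻ z, ‖S (u n z)‖ₑ ∂μ ≤ M) (k : ℕ) :
    AEMeasurable (fun z => ∫⁻ ξ, ‖S ξ * cutoff k ξ‖ₑ ∂(ν z)) μ ∧
    ∫⁻ z, ∫⁻ ξ, ‖S ξ * cutoff k ξ‖ₑ ∂(ν z) ∂μ ≤ M := by
  have hw := hν.tendsto_cutoff hS.abs k
  have hint := hw.memLp_limit.integrable le_top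
  have heq : (fun z => ∫⁻ ξ, ‖S ξ * cutoff k ξ‖ₑ ∂(ν z)) =ᵐ[μ]
      fun z => ENNReal.ofReal (∫ ξ, |S ξ| * cutoff k ξ ∂(ν z)) := by
    filter_upwards [hν.isProbabilityMeasure] with z hz
    rw [← ofReal_integral_norm_eq_lintegral_enorm (integrable_mul_cutoff hS k (ν z))]
    simp [abs_of_nonneg (cutoff_nonneg k _)]
  refine ⟨hint.aemeasurable.ennreal_ofReal.congr heq.symm, ?_⟩
  rw [lintegral_congr_ae heq, ← ofReal_integral_eq_lintegral_ofReal hint (.of_forall fun z =>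
    integral_nonneg fun ξ => mul_nonneg (abs_nonneg _) (cutoff_nonneg _ _))]
  refine ENNReal.ofReal_le_of_le_toReal ?_
  have hlim := hw.tendsto (fun _ => 1) (integrable_const 1)
  simp only [mul_one] at hlim
  refine le_of_tendsto hlim (.of_forall fun n => (le_abs_self _).trans ?_)
  rw [← Real.norm_eq_abs, ← toReal_enorm]
  refine ENNReal.toReal_mono hM ((enorm_integral_le_lintegral_enorm _).trans
    ((lintegral_mono fun z => ?_).trans (hSM n)))
  rw [enorm_le_iff_norm_le, norm_mul, Real.norm_eq_abs, abs_abs, Real.norm_eq_abs, Real.norm_eq_abs,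
    abs_of_nonneg (cutoff_nonneg _ _)]
  exact mul_le_of_le_one_right (abs_nonneg _) (cutoff_le_one _ _)

/-- The first absolute moments of `S` under `ν z` are dominated by an integrable function of `z`.
The dominating function is the `liminf` of the cut-off moments: it is measurable because those are,
whereas the measurability of the full moment is not immediate. -/
theorem IsYoungMeasure.exists_integrable_bound (hν : IsYoungMeasure μ u ν)
    (hS : Continuous S) {M : ℝ≥0∞} (hM : M ≠ ⊤) (hSM : ∀ n, ∫⁻ z, ‖S (u n z)‖ₑ ∂μ ≤ M) :
    ∃ G : X → ℝ, Integrable G μ ∧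
      ∀ᵐ z ∂μ, Integrable S (ν z) ∧ ∫ ξ, ‖S ξ‖ ∂(ν z) ≤ G z := by
  set H : X → ℝ≥0∞ := fun z => liminf (fun k => ∫⁻ ξ, ‖S ξ * cutoff k ξ‖ₑ ∂(ν z)) atTop with hH
  have hb := hν.lintegral_lintegral_cutoff_le hS hM hSM
  have hHm : AEMeasurable H μ := by
    simp only [hH, liminf_eq_iSup_iInf_of_nat]
    exact AEMeasurable.iSup fun _ => AEMeasurable.iInf fun i => AEMeasurable.iInf fun _ => (hb i).1
  have hHi : ∫⁻ z, H z ∂μ ≠ ⊤ := by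
    refine ne_top_of_le_ne_top hM ((lintegral_liminf_le' fun k => (hb k).1).trans ?_)
    exact (liminf_le_liminf (.of_forall fun k => (hb k).2)).trans (by simp)
  refine ⟨fun z => (H z).toReal, integrable_toReal_of_lintegral_ne_top hHm hHi, ?_⟩
  filter_upwards [ae_lt_top' hHm hHi] with z hz
  have hle : ∫⁻ ξ, ‖S ξ‖ₑ ∂(ν z) ≤ H z := by
    refine le_trans (lintegral_mono fun ξ => ?_) (lintegral_liminf_le fun k =>
      (hS.mul (continuous_cutoff k)).measurable.enorm)
    refine (Tendsto.liminf_eq ?_).ge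
    refine tendsto_const_nhds.congr' ?_
    filter_upwards [eventually_cutoff_eq_one ξ] with k hk
    simp [hk]
  refine ⟨⟨hS.aestronglyMeasurable, hle.trans_lt hz⟩, ?_⟩
  rw [integral_norm_eq_lintegral_enorm hS.aestronglyMeasurable]
  exact ENNReal.toReal_mono hz.ne hle

/-- Along an `L^p`-uniformly integrable sequence, the Young measure represents the weak limits not
only of `C_0` functions, but of all continuous functions of growth `p`. -/
theorem IsYoungMeasure.tendstoWeaklyL1_comp (hν : IsYoungMeasure μ u ν)
    (hu : LpUniformlyIntegrable μ p u) (hp : 0 ≤ p) (hS : Continuous S)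
    (hA : 0 ≤ A) (hSA : ∀ ξ, |S ξ| ≤ A * (1 + |ξ| ^ p)) :
    TendstoWeaklyL1 μ (fun n z => S (u n z)) (fun z => ∫ ξ, S ξ ∂(ν z)) ∧
    ∀ᵐ z ∂μ, Integrable S (ν z) := by
  obtain ⟨M, hM, hSM⟩ := hu.exists_lintegral_comp_le hA hSA
  obtain ⟨G, hG, hSG⟩ := hν.exists_integrable_bound hS hM hSM
  have hint : ∀ n, Integrable (fun z => S (u n z)) μ := fun n =>
    ⟨hS.comp_aestronglyMeasurable (hu.aestronglyMeasurable n), (hSM n).trans_lt hM.lt_top⟩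
  have hle : ∀ k ξ, ‖S ξ * cutoff k ξ‖ ≤ ‖S ξ‖ := fun k ξ => by
    rw [norm_mul, Real.norm_of_nonneg (cutoff_nonneg k ξ)]
    exact mul_le_of_le_one_right (norm_nonneg _) (cutoff_le_one _ _)
  have hlim : ∀ᵐ z ∂μ, Tendsto (fun k => ∫ ξ, S ξ * cutoff k ξ ∂(ν z)) atTop
      (𝓝 (∫ ξ, S ξ ∂(ν z))) := by
    filter_upwards [hSG] with z hz
    refine tendsto_integral_of_dominated_convergence (fun ξ => ‖S ξ‖)
      (fun k => (hS.mul (continuous_cutoff k)).aestronglyMeasurable) hz.1.norm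
      (fun k => .of_forall (hle k)) (.of_forall fun ξ => ?_)
    refine tendsto_const_nhds.congr' ?_
    filter_upwards [eventually_cutoff_eq_one ξ] with k hk
    simp [hk]
  have hcut := fun k => hν.tendsto_cutoff hS k
  have hνm : AEStronglyMeasurable (fun z => ∫ ξ, S ξ ∂(ν z)) μ :=
    aestronglyMeasurable_of_tendsto_ae atTop (fun k => (hcut k).memLp_limit.1) hlim
  refine ⟨⟨hint, hG.mono' hνm ?_, fun ψ hψ => ?_⟩, hSG.mono fun z hz => hz.1⟩
  · filter_upwards [hSG] with z hz using (norm_integral_le_integral_norm _).trans hz.2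
  have hψi : Integrable ψ μ := hψ.integrable le_top
  have hψs : eLpNormEssSup ψ μ ≠ ⊤ := by
    rw [← eLpNorm_exponent_top]
    exact hψ.2.ne
  have hR : Tendsto (fun k : ℕ => (k : ℝ) + 1) atTop atTop :=
    tendsto_atTop_add_const_right _ _ tendsto_natCast_atTop_atTop
  have huni := tendstoUniformly_integral_of_enorm_le
    (F := fun k n z => S (u n z) * cutoff (k + 1) (u n z) * ψ z)
    (f := fun n z => S (u n z) * ψ z) (m := μ)
    (fun k n => hψi.mul_of_top_right ((hcut (k + 1)).memLp n))
    (fun n => (hint n).mul_of_top_left hψ)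
    (hu.tendsto_tail_nat hR (ENNReal.mul_ne_top hψs ENNReal.ofReal_ne_top))
    (fun k n => hu.lintegral_comp_sub_cutoff_le hp hA hSA k n)
  refine huni.tendsto_of_eventually_tendsto
    (.of_forall fun k => (hcut (k + 1)).tendsto ψ hψi) ?_
  refine tendsto_integral_of_dominated_convergence (fun z => G z * ‖ψ z‖)
    (fun k => (hcut (k + 1)).memLp_limit.1.mul hψ.1) (hG.mul_of_top_left hψ.norm)
    (fun k => ?_) ?_
  · filter_upwards [hSG] with z hz
    rw [norm_mul]
    refine mul_le_mul_of_nonneg_right ((norm_integral_le_integral_norm _).trans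
      (le_trans ?_ hz.2)) (norm_nonneg _)
    exact integral_mono_of_nonneg (.of_forall fun _ => norm_nonneg _) hz.1.norm
      (.of_forall (hle (k + 1)))
  · filter_upwards [hlim] with z hz
    exact ((tendsto_add_atTop_iff_nat 1).2 hz).mul_const _

end YoungMeasure

/-! ### Growth of the nonlinearity -/

/-- The growth bound on the derivative integrates to growth of order `p`. -/
lemma abs_le_of_abs_deriv_le_rpow {S : ℝ → ℝ} {p C : ℝ} (hp : 1 ≤ p) (hC : 0 ≤ C)
    (hS : ∀ v, AbsolutelyContinuousOnInterval S 0 v)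
    (hSC : ∀ᵐ ξ : ℝ, |deriv S ξ| ≤ C * (|ξ| ^ (p - 1) + 1)) (v : ℝ) :
    |S v| ≤ (|S 0| + 2 * C) * (1 + |v| ^ p) := by
  have h1 : ‖∫ ξ in (0 : ℝ)..v, deriv S ξ‖ ≤ C * (|v| ^ (p - 1) + 1) * |v - 0| := by
    refine intervalIntegral.norm_integral_le_of_norm_le_const_ae ?_
    filter_upwards [hSC] with ξ hξ hm
    refine hξ.trans ?_
    have : |ξ| ≤ |v| := by
      simpa using Set.abs_sub_left_of_mem_uIcc (Set.uIoc_subset_uIcc hm)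
    gcongr
  rw [(hS v).integral_deriv_eq_sub, sub_zero, mul_assoc, add_mul, one_mul,
    rpow_sub_one_mul_self (abs_nonneg v) hp, Real.norm_eq_abs] at h1
  have h2 : |v| ≤ 1 + |v| ^ p := by
    rcases le_total |v| 1 with h | h
    · linarith [Real.rpow_nonneg (abs_nonneg v) p]
    · linarith [Real.self_le_rpow_of_one_le h hp]
  have h3 : |S v| ≤ |S v - S 0| + |S 0| := by simpa using abs_add_le (S v - S 0) (S 0)
  have h4 := Real.rpow_nonneg (abs_nonneg v) p
  nlinarith [mul_le_mul_of_nonneg_left h2 hC, mul_nonneg (abs_nonneg (S 0)) h4]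

lemma continuous_of_absolutelyContinuousOnInterval {S : ℝ → ℝ}
    (hS : ∀ a b : ℝ, AbsolutelyContinuousOnInterval S a b) : Continuous S := by
  refine continuous_iff_continuousAt.2 fun x => (hS (x - 1) (x + 1)).continuousOn.continuousAt ?_
  rw [Set.uIcc_of_le (by linarith)]
  exact Icc_mem_nhds (by linarith) (by linarith)

theorem mainTheorem7 (d : ℕ) (T : ℝ) (hT : 0 < T)
    (K : Set (ℝ × EuclideanSpace ℝ (Fin d))) (hK : IsCompact K)
    (hKT : K ⊆ Set.Ioo 0 T ×ˢ Set.univ)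
    (p : ℝ) (hp : 1 ≤ p)
    (u : ℕ → ℝ × EuclideanSpace ℝ (Fin d) → ℝ)
    (hu : LpUniformlyIntegrable (volume.restrict K) p u)
    (g : ℝ × EuclideanSpace ℝ (Fin d) → ℝ → ℝ)
    (hg : TendstoWeakStarLinfty ((volume.restrict K).prod (volume : Measure ℝ))
      (fun n w => kineticFunction w.2 (u n w.1)) (fun w => g w.1 w.2))
    (S : ℝ → ℝ) (hS : ∀ a b : ℝ, AbsolutelyContinuousOnInterval S a b)
    (C : ℝ) (hSC : ∀ᵐ ξ : ℝ, |deriv S ξ| ≤ C * (|ξ| ^ (p - 1) + 1)) :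
    (∀ᵐ z ∂(volume.restrict K), Integrable (fun ξ : ℝ => deriv S ξ * g z ξ)) ∧
    TendstoWeaklyL1 (volume.restrict K) (fun n z => S (u n z))
      (fun z => S 0 + ∫ ξ : ℝ, deriv S ξ * g z ξ) ∧
    ∀ ν : ℝ × EuclideanSpace ℝ (Fin d) → Measure ℝ,
      IsYoungMeasure (volume.restrict K) u ν →
        TendstoWeaklyL1 (volume.restrict K) (fun n z => S (u n z))
          (fun z => ∫ ξ, S ξ ∂(ν z)) ∧
        ∀ᵐ z ∂(volume.restrict K),
          Integrable S (ν z) ∧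
          ∫ ξ, S ξ ∂(ν z) = S 0 + ∫ ξ : ℝ, deriv S ξ * g z ξ := by
  have : IsFiniteMeasure (volume.restrict K) :=
    isFiniteMeasure_restrict.2 hK.measure_lt_top.ne
  have hC : 0 ≤ C := by
    obtain ⟨ξ, hξ⟩ := hSC.exists
    have : 0 < |ξ| ^ (p - 1) + 1 := by positivity
    exact nonneg_of_mul_nonneg_left ((abs_nonneg _).trans hξ) this
  obtain ⟨h1, h2⟩ := hu.tendstoWeaklyL1_of_kineticFunction hp hC hg (hS 0) hSC
  refine ⟨h1, h2, fun ν hν => ?_⟩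
  obtain ⟨h3, h4⟩ := hν.tendstoWeaklyL1_comp hu (by linarith)
    (continuous_of_absolutelyContinuousOnInterval hS) (by positivity)
    (abs_le_of_abs_deriv_le_rpow hp hC (hS 0) hSC)
  exact ⟨h3, h4.and (h3.limit_ae_unique h2)⟩
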